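/- Let $n \ge 2$ and let $F_n$ be the free group of rank $n$. Let $\gamma_1 = F_n$ and $\gamma_{c+1} = [\gamma_c, F_n]$ for $c \ge 1$ be its lower central series. For $c \ge 0$ let $G_c$ be the kernel of the natural map ${\rm Aut}(F_n) \to {\rm Aut}(F_n/\gamma_{c+1})$ (the Andreadakis filtration), and let $H_c$ be the image of $G_c$ under the projection $\pi : {\rm Aut}(F_n) \to {\rm Out}(F_n)$. Let ${\rm ad} : F_n \to {\rm Aut}(F_n)$ be the map induced by the action of $F_n$ on itself by conjugation. Then for every $c \ge 1$ the sequence $$0 \to \gamma_c/\gamma_{c+1} \to G_c/G_{c+1} \to H_c/H_{c+1} \to 0$$ is an exact sequence of free abelian groups, where the second and third maps are induced by ${\rm ad}$ and $\pi$ respectively. -/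

import Mathlib

namespace AndreadakisOut

universe u

/-- The lower central series of `F` with the indexing `γ₁ = F`, `γ_{c+1} = [γ_c, F]`.
(Only indices `c ≥ 1` are meaningful; the value at `0` is `F`.) -/
def gamma (F : Type u) [Group F] (c : ℕ) : Subgroup F :=
  (⊤ : Subgroup F).lowerCentralSeries (c - 1)

theorem gamma_one (F : Type u) [Group F] : gamma F 1 = ⊤ := rfl

theorem gamma_succ (F : Type u) [Group F] (c : ℕ) (hc : 1 ≤ c) :
    gamma F (c + 1) = ⁅gamma F c, (⊤ : Subgroup F)⁆ := by
  obtain ⟨d, rfl⟩ := Nat.exists_eq_add_of_le' hc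
  rfl

instance gamma_characteristic (F : Type u) [Group F] (c : ℕ) :
    (gamma F c).Characteristic :=
  Subgroup.lowerCentralSeries_characteristic _ _

theorem gamma_succ_le (F : Type u) [Group F] (c : ℕ) : gamma F (c + 1) ≤ gamma F c := by
  rcases Nat.eq_zero_or_pos c with rfl | hc
  · exact le_refl _
  · rw [gamma_succ F c hc]
    exact Subgroup.commutator_le_left _ _

/-- The natural map `Aut(F) → Aut(F/N)` for a characteristic subgroup `N` of `F`. -/
def autQuotient {F : Type u} [Group F] (N : Subgroup F) [hN : N.Characteristic] :
    MulAut F →* MulAut (F ⧸ N) where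
  toFun ψ := QuotientGroup.congr N N ψ (Subgroup.characteristic_iff_map_eq.mp hN ψ)
  map_one' := by
    ext x
    induction x using QuotientGroup.induction_on with
    | H x => rfl
  map_mul' φ ψ := by
    ext x
    induction x using QuotientGroup.induction_on with
    | H x => rfl

/-- The Andreadakis filtration of `Aut(F)`: `G_c` is the kernel of
`Aut(F) → Aut(F/γ_{c+1})`. -/
def andreadakis (F : Type u) [Group F] (c : ℕ) : Subgroup (MulAut F) :=
  (autQuotient (gamma F (c + 1))).ker

instance andreadakis_normal (F : Type u) [Group F] (c : ℕ) : (andreadakis F c).Normal := by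
  unfold andreadakis
  infer_instance

theorem mem_andreadakis_iff {F : Type u} [Group F] {c : ℕ} {ψ : MulAut F} :
    ψ ∈ andreadakis F c ↔ ∀ x : F, x⁻¹ * ψ x ∈ gamma F (c + 1) := by
  unfold andreadakis
  rw [MonoidHom.mem_ker]
  constructor
  · intro h x
    have hx := DFunLike.congr_fun h (x : F ⧸ gamma F (c + 1))
    exact QuotientGroup.eq.mp hx.symm
  · intro h
    ext x
    induction x using QuotientGroup.induction_on with
    | H x => exact (QuotientGroup.eq.mpr (h x)).symm

theorem andreadakis_succ_le (F : Type u) [Group F] (c : ℕ) :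
    andreadakis F (c + 1) ≤ andreadakis F c := fun _ h =>
  mem_andreadakis_iff.mpr fun x => gamma_succ_le F (c + 1) (mem_andreadakis_iff.mp h x)

/-- The group of inner automorphisms of `F`, as a subgroup of `Aut(F)`. -/
def inner (F : Type u) [Group F] : Subgroup (MulAut F) := (MulAut.conj : F →* MulAut F).range

instance inner_normal (F : Type u) [Group F] : (inner F).Normal where
  conj_mem := by
    rintro _ ⟨y, rfl⟩ ψ
    refine ⟨ψ y, ?_⟩
    ext x
    simp [MulAut.conj_apply]

/-- The outer automorphism group `Out(F) = Aut(F)/Inn(F)`. -/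
abbrev Out (F : Type u) [Group F] : Type u := MulAut F ⧸ inner F

/-- The projection `π : Aut(F) → Out(F)`. -/
def proj (F : Type u) [Group F] : MulAut F →* Out F := QuotientGroup.mk' (inner F)

/-- `H_c`, the image of `G_c` in `Out(F)`. -/
def outFiltration (F : Type u) [Group F] (c : ℕ) : Subgroup (Out F) :=
  (andreadakis F c).map (proj F)

instance outFiltration_normal (F : Type u) [Group F] (c : ℕ) : (outFiltration F c).Normal :=
  Subgroup.Normal.map inferInstance (proj F) (QuotientGroup.mk'_surjective _)

theorem outFiltration_succ_le (F : Type u) [Group F] (c : ℕ) :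
    outFiltration F (c + 1) ≤ outFiltration F c :=
  Subgroup.map_mono (andreadakis_succ_le F c)

/-- The quotient `γ_c / γ_{c+1}`. -/
abbrev GammaQuot (F : Type u) [Group F] (c : ℕ) : Type u :=
  gamma F c ⧸ (gamma F (c + 1)).subgroupOf (gamma F c)

/-- The quotient `G_c / G_{c+1}`. -/
abbrev AndreadakisQuot (F : Type u) [Group F] (c : ℕ) : Type u :=
  andreadakis F c ⧸ (andreadakis F (c + 1)).subgroupOf (andreadakis F c)

/-- The quotient `H_c / H_{c+1}`. -/
abbrev OutQuot (F : Type u) [Group F] (c : ℕ) : Type u :=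
  outFiltration F c ⧸ (outFiltration F (c + 1)).subgroupOf (outFiltration F c)

/-- Conjugation by an element of `γ_c` lies in `G_c`. -/
theorem conj_mem_andreadakis {F : Type u} [Group F] {c : ℕ} {y : F} (hy : y ∈ gamma F c) :
    MulAut.conj y ∈ andreadakis F c := by
  rw [mem_andreadakis_iff]
  intro x
  rcases Nat.eq_zero_or_pos c with rfl | hc
  · exact Subgroup.mem_top _
  · rw [gamma_succ F c hc, Subgroup.commutator_comm]
    have h := Subgroup.commutator_mem_commutator (Subgroup.mem_top x⁻¹) hy
    simpa [commutatorElement_def, MulAut.conj_apply, mul_assoc] using h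

/-- The conjugation map `ad : y ↦ (x ↦ y x y⁻¹)`, restricted to `γ_c → G_c`. -/
def adRestrict (F : Type u) [Group F] (c : ℕ) : gamma F c →* andreadakis F c :=
  (MulAut.conj.comp (gamma F c).subtype).codRestrict (andreadakis F c)
    fun y => conj_mem_andreadakis y.2

/-- The map `γ_c / γ_{c+1} → G_c / G_{c+1}` induced by `ad`. -/
def adQuot (F : Type u) [Group F] (c : ℕ) : GammaQuot F c →* AndreadakisQuot F c :=
  QuotientGroup.map _ _ (adRestrict F c) fun _ hy => conj_mem_andreadakis hy

/-- The projection `π` restricted to `G_c → H_c`. -/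
def projRestrict (F : Type u) [Group F] (c : ℕ) : andreadakis F c →* outFiltration F c :=
  (proj F).subgroupMap (andreadakis F c)

/-- The map `G_c / G_{c+1} → H_c / H_{c+1}` induced by `π`. -/
def projQuot (F : Type u) [Group F] (c : ℕ) : AndreadakisQuot F c →* OutQuot F c :=
  QuotientGroup.map _ _ (projRestrict F c) fun _ hψ => Subgroup.mem_map_of_mem (proj F) hψ

/-- A (multiplicatively written) group is free abelian if it is isomorphic to the free abelian
group on some set. -/
def IsFreeAbelian (A : Type u) [Group A] : Prop :=
  ∃ ι : Type u, Nonempty (A ≃* Multiplicative (FreeAbelianGroup ι))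

end AndreadakisOut

namespace AndreadakisOut

/-! The Magnus expansion `x ↦ 1 + x t` attaches to each element of `γ_k` a coefficient of `t ^ k`
(`Lead`), additive in products and turning group commutators into ring commutators. Everything rests
on `exists_pow_of_lead_zmod`: if this coefficient vanishes modulo `m` for `v ∈ γ_c`, then `v` is an
`m`-th power modulo `γ_{c+1}`. The case `m = 0` is Magnus' theorem, that `γ_c / γ_{c+1}` embeds in a
finitely generated torsion-free module. The proof strips off one generator of least weight at a
time; Lazard elimination (`lift_iterAd_injective`) keeps the leading coefficients free.

The coefficients of `x⁻¹ ψ(x)`, for `x` a generator, embed `G_c / G_{c+1}` in a module of the same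
kind (`johnson`). In rank at least two, an element of positive degree commuting with all generators
is zero over any coefficient ring (`eq_zero_of_commute_ι`). Over `ℤ` this shows that `ad y ∈
G_{c+1}` forces `y ∈ γ_{c+1}`, which gives injectivity and, one level lower, exactness in the
middle.

Torsion-freeness of `H_c / H_{c+1}` uses coefficients modulo `m`: if `ψ ^ m ≡ ad y`, the leading
coefficient of `y` is central modulo `m`, hence zero, so `y ≡ u ^ m` and `ψ ≡ ad u` because `G_c /
G_{c+1}` is torsion-free. -/

open PowerSeries
open scoped commutatorElement

/-! ### Commutators in the lower central series. -/

/-- The three subgroups lemma modulo a normal subgroup. -/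
theorem commutator_commutator_le_of_rotate {G : Type*} [Group G] {A B C N : Subgroup G} [N.Normal]
    (h1 : ⁅⁅B, C⁆, A⁆ ≤ N) (h2 : ⁅⁅C, A⁆, B⁆ ≤ N) : ⁅⁅A, B⁆, C⁆ ≤ N := by
  have key : ∀ K : Subgroup G, K ≤ N ↔ K.map (QuotientGroup.mk' N) = ⊥ := fun K => by
    rw [Subgroup.map_eq_bot_iff, QuotientGroup.ker_mk']
  rw [key, Subgroup.map_commutator, Subgroup.map_commutator] at *
  exact Subgroup.commutator_commutator_eq_bot_of_rotate h1 h2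

theorem gamma_antitone (F : Type*) [Group F] : Antitone (gamma F) :=
  antitone_nat_of_succ_le (gamma_succ_le F)

/-- Induction on `j`: the three subgroups lemma trades a step in the second factor for a step in the
first or in the total weight. -/
theorem gamma_commutator_le (F : Type*) [Group F] (i j : ℕ) (hi : 1 ≤ i) (hj : 1 ≤ j) :
    ⁅gamma F i, gamma F j⁆ ≤ gamma F (i + j) := by
  induction j, hj using Nat.le_induction generalizing i with
  | base => rw [gamma_one, gamma_succ F i hi]
  | succ j hj ih =>
    rw [gamma_succ F j hj, Subgroup.commutator_comm]
    apply commutator_commutator_le_of_rotate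
    · rw [Subgroup.commutator_comm ⊤, ← gamma_succ F i hi]
      exact (ih (i + 1) (by omega)).trans (by rw [show i + 1 + j = i + (j + 1) by ring])
    · rw [← add_assoc, gamma_succ F (i + j) (by omega)]
      exact Subgroup.commutator_mono (ih i hi) le_rfl

theorem commutatorElement_mem_gamma {F : Type*} [Group F] {i j : ℕ} (hi : 1 ≤ i) (hj : 1 ≤ j)
    {x y : F} (hx : x ∈ gamma F i) (hy : y ∈ gamma F j) : ⁅x, y⁆ ∈ gamma F (i + j) :=
  gamma_commutator_le F i j hi hj (Subgroup.commutator_mem_commutator hx hy)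

/-! ### The Magnus expansion and its leading coefficients. -/

section Magnus

variable (R : Type*) [CommRing R] {α : Type*}

/-- The unit `1 + a t` of the ring of formal power series over a ring. -/
noncomputable def onePlusUnit {B : Type*} [Ring B] (a : B) : B⟦X⟧ˣ where
  val := 1 + C a * X
  inv := PowerSeries.mk fun n => (-a) ^ n
  val_inv := by
    ext n
    rw [add_mul, one_mul, map_add, mul_assoc, coeff_C_mul]
    cases n with
    | zero => simp
    | succ n => simp [coeff_succ_X_mul, pow_succ', coeff_one]
  inv_val := by
    ext n
    rw [mul_add, mul_one, map_add, ← mul_assoc]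
    cases n with
    | zero => simp
    | succ n => simp [coeff_succ_mul_X, pow_succ, coeff_one]

/-- The Magnus expansion `x ↦ 1 + X_x t` of the free group. -/
noncomputable def magnus : FreeGroup α →* (FreeAlgebra R α)⟦X⟧ˣ :=
  FreeGroup.lift fun i => onePlusUnit (FreeAlgebra.ι R i)

/-- `a` is the coefficient of `t ^ k` in the Magnus expansion of `g`,
which is congruent to `1` modulo `t ^ k`. -/
def Lead (k : ℕ) (g : FreeGroup α) (a : FreeAlgebra R α) : Prop :=
  ∃ q : (FreeAlgebra R α)⟦X⟧, (magnus R g : (FreeAlgebra R α)⟦X⟧) = 1 + q * X ^ k ∧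
    constantCoeff q = a

variable {R}

theorem constantCoeff_magnus (g : FreeGroup α) :
    constantCoeff (magnus R g : (FreeAlgebra R α)⟦X⟧) = 1 := by
  have h : (Units.map (constantCoeff (R := FreeAlgebra R α)).toMonoidHom).comp (magnus R) =
      (1 : FreeGroup α →* (FreeAlgebra R α)ˣ) := by
    ext i
    simp [magnus, onePlusUnit]
  exact congrArg Units.val (DFunLike.congr_fun h g)

theorem Lead.coeff_eq {k : ℕ} (hk : 1 ≤ k) {g : FreeGroup α} {a : FreeAlgebra R α}
    (h : Lead R k g a) : coeff k (magnus R g : (FreeAlgebra R α)⟦X⟧) = a := by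
  obtain ⟨q, hq, rfl⟩ := h
  rw [hq, map_add, coeff_one, if_neg (by omega), zero_add]
  simpa using coeff_mul_X_pow q k 0

theorem Lead.unique {k : ℕ} (hk : 1 ≤ k) {g : FreeGroup α} {a b : FreeAlgebra R α}
    (ha : Lead R k g a) (hb : Lead R k g b) : a = b := by
  rw [← ha.coeff_eq hk, ← hb.coeff_eq hk]

theorem lead_one (k : ℕ) : Lead R k (1 : FreeGroup α) 0 := ⟨0, by simp, by simp⟩

theorem Lead.mul {k : ℕ} (hk : 1 ≤ k) {g h : FreeGroup α} {a b : FreeAlgebra R α}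
    (ha : Lead R k g a) (hb : Lead R k h b) : Lead R k (g * h) (a + b) := by
  obtain ⟨q, hq, rfl⟩ := ha
  obtain ⟨r, hr, rfl⟩ := hb
  refine ⟨q + r + q * r * X ^ k, ?_, ?_⟩
  · rw [map_mul, Units.val_mul, hq, hr]
    have : q * X ^ k * (r * X ^ k) = q * r * X ^ k * X ^ k := by
      rw [mul_assoc q, ← mul_assoc (X ^ k) r, (commute_X_pow r k).symm.eq, ← mul_assoc, ← mul_assoc]
    rw [mul_add, mul_one, add_mul, one_mul, this, add_mul, add_mul]
    abel
  · simp [show k ≠ 0 by omega]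

theorem Lead.inv {k : ℕ} {g : FreeGroup α} {a : FreeAlgebra R α}
    (ha : Lead R k g a) : Lead R k g⁻¹ (-a) := by
  obtain ⟨q, hq, rfl⟩ := ha
  refine ⟨-(q * (magnus R g⁻¹ : (FreeAlgebra R α)⟦X⟧)), ?_, ?_⟩
  · have h1 : (magnus R g : (FreeAlgebra R α)⟦X⟧) * (magnus R g⁻¹ : (FreeAlgebra R α)⟦X⟧) = 1 := by
      rw [← Units.val_mul, ← map_mul]; simp
    rw [hq, add_mul, one_mul, mul_assoc, X_pow_mul, ← mul_assoc] at h1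
    rw [neg_mul, ← sub_eq_add_neg, ← h1]
    simp
  · rw [map_neg, map_mul, constantCoeff_magnus, mul_one]

theorem Lead.zpow {k : ℕ} (hk : 1 ≤ k) {g : FreeGroup α} {a : FreeAlgebra R α}
    (ha : Lead R k g a) (n : ℤ) : Lead R k (g ^ n) (n • a) := by
  induction n with
  | zero => simpa using lead_one k
  | succ n ih => simpa [zpow_add_one, add_smul] using ih.mul hk ha
  | pred n ih => 
    rw [zpow_sub_one, sub_smul, one_smul, sub_eq_add_neg]
    exact ih.mul hk ha.inv

/-- Writing `M` for the expansion, `M ⁅g, h⁆ - 1 = (M (g * h) - M (h * g)) * M (g⁻¹ * h⁻¹)`. The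
bracket is `(q * r - r * q) * X ^ (i + j)`, and the last factor has constant term `1`. -/
theorem Lead.commutator {i j : ℕ} {g h : FreeGroup α} {a b : FreeAlgebra R α}
    (ha : Lead R i g a) (hb : Lead R j h b) : Lead R (i + j) ⁅g, h⁆ (a * b - b * a) := by
  obtain ⟨q, hq, rfl⟩ := ha
  obtain ⟨r, hr, rfl⟩ := hb
  set M : FreeGroup α → (FreeAlgebra R α)⟦X⟧ := fun g => ↑(magnus R g)
  have hM : ∀ g h, M (g * h) = M g * M h := fun g h => by simp [M]
  refine ⟨(q * r - r * q) * M (g⁻¹ * h⁻¹), ?_, ?_⟩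
  · have h1 : M (g * h) - M (h * g) = (q * r - r * q) * X ^ (i + j) := by
      simp only [hM, M, hq, hr]
      have e1 : q * X ^ i * (r * X ^ j) = q * r * X ^ (i + j) := by
        rw [mul_assoc q, ← mul_assoc (X ^ i) r, X_pow_mul, mul_assoc, mul_assoc, pow_add]
      have e2 : r * X ^ j * (q * X ^ i) = r * q * X ^ (i + j) := by
        rw [mul_assoc r, ← mul_assoc (X ^ j) q, X_pow_mul, mul_assoc, mul_assoc, add_comm, pow_add]
      rw [sub_mul, ← e1, ← e2]
      noncomm_ring
    have h2 : M (g * h) * M (g⁻¹ * h⁻¹) = M ⁅g, h⁆ := by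
      rw [← hM, commutatorElement_def, mul_assoc, mul_assoc, mul_assoc]
    have h3 : M (h * g) * M (g⁻¹ * h⁻¹) = 1 := by
      rw [← hM]
      simp [M]
    rw [mul_assoc, ← X_pow_mul, ← mul_assoc, ← h1, sub_mul, h2, h3]
    simp [M]
  · rw [map_mul, constantCoeff_magnus]
    simp

theorem lead_of (i : α) : Lead R 1 (FreeGroup.of i) (FreeAlgebra.ι R i) :=
  ⟨C (FreeAlgebra.ι R i), by simp [magnus, onePlusUnit], by simp⟩

theorem Lead.zero_of_lt {i k : ℕ} (h : i < k) {g : FreeGroup α} {a : FreeAlgebra R α}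
    (ha : Lead R k g a) : Lead R i g 0 := by
  obtain ⟨q, hq, rfl⟩ := ha
  refine ⟨q * X ^ (k - i), ?_, ?_⟩
  · rw [hq, mul_assoc, ← pow_add, Nat.sub_add_cancel h.le]
  · simp [show k - i ≠ 0 by omega]

variable (R α) in
/-- The group of elements whose Magnus expansion is congruent to `1` modulo `t ^ k`. -/
def magnusDepth (k : ℕ) (hk : 1 ≤ k) : Subgroup (FreeGroup α) where
  carrier := {g | ∃ a, Lead R k g a}
  mul_mem' := fun ⟨_, ha⟩ ⟨_, hb⟩ => ⟨_, ha.mul hk hb⟩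
  one_mem' := ⟨_, lead_one k⟩
  inv_mem' := fun ⟨_, ha⟩ => ⟨_, ha.inv⟩

theorem exists_lead_of_mem_gamma {k : ℕ} (hk : 1 ≤ k) {g : FreeGroup α}
    (hg : g ∈ gamma (FreeGroup α) k) : ∃ a, Lead R k g a := by
  suffices h : gamma (FreeGroup α) k ≤ magnusDepth R α k hk from h hg
  have h1 : ∀ g : FreeGroup α, g ∈ magnusDepth R α 1 le_rfl := fun g => by
    induction g using FreeGroup.induction_on with
    | C1 => exact one_mem _
    | of i => exact ⟨_, lead_of i⟩
    | inv_of i h => exact inv_mem h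
    | mul x y hx hy => exact mul_mem hx hy
  clear hg g
  induction k, hk using Nat.le_induction with
  | base => exact fun g _ => h1 g
  | succ k hk ih =>
    rw [gamma_succ _ k hk, Subgroup.commutator_le]
    intro x hx y _
    obtain ⟨a, ha⟩ := ih hx
    obtain ⟨b, hb⟩ := h1 y
    exact ⟨_, ha.commutator hb⟩

end Magnus

/-! ### Lazard elimination in free associative algebras. -/

section Elimination

variable (R : Type*) [CommRing R] {Y : Type*}

/-- The family of iterated commutators `[x, [x, … [x, y]]]` with `j` entries `x`, in a ring. -/
def iterAd {B : Type*} [Ring B] (x : B) : ℕ → B → B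
  | 0, y => y
  | j + 1, y => x * iterAd x j y - iterAd x j y * x

theorem map_iterAd {B C : Type*} [Ring B] [Ring C] (f : B →+* C) (x : B) (j : ℕ) (y : B) :
    f (iterAd x j y) = iterAd (f x) j (f y) := by
  induction j with
  | zero => rfl
  | succ j ih => simp [iterAd, ih]

variable (Y) in
/-- The derivation of the free algebra on `ℕ × Y` sending `(j, y)` to `(j + 1, y)`, packaged with
the identity as a homomorphism to the trivial square-zero extension. -/
noncomputable def shiftExt :
    FreeAlgebra R (ℕ × Y) →ₐ[R] TrivSqZeroExt (FreeAlgebra R (ℕ × Y)) (FreeAlgebra R (ℕ × Y)) :=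
  FreeAlgebra.lift R fun p =>
    TrivSqZeroExt.inl (FreeAlgebra.ι R p) + TrivSqZeroExt.inr (FreeAlgebra.ι R (p.1 + 1, p.2))

theorem fst_shiftExt (a : FreeAlgebra R (ℕ × Y)) : (shiftExt R Y a).fst = a := by
  have h : (TrivSqZeroExt.fstHom R (FreeAlgebra R (ℕ × Y)) (FreeAlgebra R (ℕ × Y))).comp
      (shiftExt R Y) = AlgHom.id R _ := by
    ext p
    simp [shiftExt]
  exact DFunLike.congr_fun h a

/-- The derivation of the free algebra on `ℕ × Y` sending `(j, y)` to `(j + 1, y)`. -/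
noncomputable def shift : Module.End R (FreeAlgebra R (ℕ × Y)) :=
  (TrivSqZeroExt.sndHom (FreeAlgebra R (ℕ × Y)) (FreeAlgebra R (ℕ × Y))).restrictScalars R ∘ₗ
    (shiftExt R Y).toLinearMap

theorem shift_mul (a b : FreeAlgebra R (ℕ × Y)) :
    shift R (a * b) = a * shift R b + shift R a * b := by
  change (shiftExt R Y (a * b)).snd = a * (shiftExt R Y b).snd + (shiftExt R Y a).snd * b
  rw [map_mul, TrivSqZeroExt.snd_mul, fst_shiftExt, fst_shiftExt]
  rfl

theorem shift_ι (p : ℕ × Y) : shift R (FreeAlgebra.ι R p) = FreeAlgebra.ι R (p.1 + 1, p.2) := by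
  change (shiftExt R Y _).snd = _
  simp [shiftExt]

/-- The commutator of a derivation with left multiplication by `a` is left multiplication by the
derivative of `a`. -/
theorem iterAd_shift (j : ℕ) (y : Y) :
    iterAd (shift R) j (LinearMap.mulLeft R (FreeAlgebra.ι R (0, y))) =
      LinearMap.mulLeft R (FreeAlgebra.ι R (j, y)) := by
  induction j with
  | zero => rfl
  | succ j ih =>
    ext b
    simp [iterAd, ih, shift_mul, shift_ι]

/-- Lazard elimination for free associative algebras: the elements `ad_x ^ j y`, for `y ≠ x`,
freely generate a subalgebra. -/
theorem lift_iterAd_injective (x : Y) :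
    Function.Injective (FreeAlgebra.lift R fun p : ℕ × {y // y ≠ x} =>
      iterAd (FreeAlgebra.ι R x) p.1 (FreeAlgebra.ι R p.2.1)) := by
  classical
  -- Let `x` act as the derivation `shift` and each `y ≠ x` as left multiplication by the generator
  -- `(0, y)`. Then `ad_x ^ j y` acts as left multiplication by `(j, y)`, so applying the operators
  -- to `1` gives a left inverse.
  let ρ : FreeAlgebra R Y →ₐ[R] Module.End R (FreeAlgebra R (ℕ × {y // y ≠ x})) :=
    FreeAlgebra.lift R fun y => if h : y = x then shift R else
      LinearMap.mulLeft R (FreeAlgebra.ι R (0, ⟨y, h⟩))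
  have h : ρ.comp (FreeAlgebra.lift R fun p : ℕ × {y // y ≠ x} =>
      iterAd (FreeAlgebra.ι R x) p.1 (FreeAlgebra.ι R p.2.1)) = Algebra.lmul R _ := by
    refine FreeAlgebra.hom_ext (funext fun p => ?_)
    have h1 := map_iterAd ρ.toRingHom (FreeAlgebra.ι R x) p.1 (FreeAlgebra.ι R p.2.1)
    have h2 : ρ (FreeAlgebra.ι R x) = shift R := by simp [ρ]
    have h3 : ρ (FreeAlgebra.ι R p.2.1) = LinearMap.mulLeft R (FreeAlgebra.ι R (0, p.2)) := by
      simp [ρ, p.2.2]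
    change ρ.toRingHom _ = iterAd (ρ _) _ (ρ _) at h1
    rw [h2, h3, iterAd_shift] at h1
    change ρ (FreeAlgebra.lift R _ (FreeAlgebra.ι R p)) = LinearMap.mulLeft R (FreeAlgebra.ι R p)
    rw [FreeAlgebra.lift_ι_apply]
    exact h1
  intro a b hab
  have h4 : ∀ a, ρ (FreeAlgebra.lift R (fun p : ℕ × {y // y ≠ x} =>
      iterAd (FreeAlgebra.ι R x) p.1 (FreeAlgebra.ι R p.2.1)) a) 1 = a := fun a => by
    have := LinearMap.congr_fun (DFunLike.congr_fun h a) 1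
    simpa using this
  rw [← h4 a, hab, h4]

/-- The generators of a free associative algebra are linearly independent. -/
theorem eq_zero_of_smul_ι_add_eq_zero {x : Y} {r : R} {s : FreeAlgebra R Y}
    (hs : s ∈ Submodule.span R (FreeAlgebra.ι R '' {y | y ≠ x}))
    (h : r • FreeAlgebra.ι R x + s = 0) : r = 0 := by
  classical
  -- Sending `x` to `ε` and the other generators to `0` reads off the coefficient of `x`.
  let φ : FreeAlgebra R Y →ₐ[R] DualNumber R :=
    FreeAlgebra.lift R fun y => if y = x then DualNumber.eps else 0
  have h1 : Submodule.span R (FreeAlgebra.ι R '' {y | y ≠ x}) ≤ φ.toLinearMap.ker := by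
    rw [Submodule.span_le]
    rintro _ ⟨y, hy, rfl⟩
    have hy : y ≠ x := hy
    simp [φ, hy]
  have h2 : φ s = 0 := h1 hs
  have h3 := congrArg (fun a => (φ a).snd) h
  simpa [h2, φ] using h3

end Elimination

/-! ### Elimination in groups. -/

section Collection

variable {G : Type*} [Group G]

/-- The iterated commutators `[x, [x, … [x, y]]]` with `j` entries `x`, in a group. -/
def iterComm (x : G) : ℕ → G → G
  | 0, y => y
  | j + 1, y => ⁅x, iterComm x j y⁆

theorem iterComm_mem_gamma {x y : G} {d e : ℕ} (hd : 1 ≤ d) (he : 1 ≤ e) (hx : x ∈ gamma G d)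
    (hy : y ∈ gamma G e) (j : ℕ) : iterComm x j y ∈ gamma G (j * d + e) := by
  induction j with
  | zero => simpa [iterComm] using hy
  | succ j ih =>
    rw [show (j + 1) * d + e = d + (j * d + e) by ring]
    exact commutatorElement_mem_gamma hd (by omega) hx ih

/-- Elimination in a group in which the iterated commutators with `x` vanish eventually
modulo `N`. -/
theorem mem_zpowers_mul {ι : Type*} {N : Subgroup G} [N.Normal] {x : G} {f : ι → G} {J : ℕ}
    (hJ : ∀ i, ∀ j ≥ J, iterComm x j (f i) ∈ N) {S : Set G}
    (hS : ∀ s ∈ S, s = x ∨ s ∈ Set.range f) {v : G} (hv : v ∈ Subgroup.closure S ⊔ N) :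
    ∃ a : ℤ, ∃ v' ∈ Subgroup.closure (Set.range fun p : ℕ × ι => iterComm x p.1 (f p.2)) ⊔ N,
      v = x ^ a * v' := by
  set H := Subgroup.closure (Set.range fun p : ℕ × ι => iterComm x p.1 (f p.2)) ⊔ N with hH
  have hgen : ∀ j i, iterComm x j (f i) ∈ H := fun j i =>
    Subgroup.mem_sup_left (Subgroup.subset_closure ⟨(j, i), rfl⟩)
  have hN : N ≤ H := le_sup_right
  have hconj : ∀ z : G, (∀ j i, z * iterComm x j (f i) * z⁻¹ ∈ H) → ∀ h ∈ H, z * h * z⁻¹ ∈ H := by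
    intro z hz h hh
    suffices H ≤ H.comap (MulAut.conj z).toMonoidHom from this hh
    nth_rewrite 1 [hH]
    refine sup_le ((Subgroup.closure_le _).mpr ?_) fun n hn => ?_
    · rintro _ ⟨⟨j, i⟩, rfl⟩
      exact hz j i
    · exact hN (Subgroup.Normal.conj_mem inferInstance n hn z)
  have h1 : ∀ h ∈ H, x * h * x⁻¹ ∈ H := by
    refine hconj x fun j i => ?_
    have : x * iterComm x j (f i) * x⁻¹ = iterComm x (j + 1) (f i) * iterComm x j (f i) := by
      simp [iterComm, commutatorElement_def]
    rw [this]
    exact mul_mem (hgen _ _) (hgen _ _)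
  have h2 : ∀ h ∈ H, x⁻¹ * h * x ∈ H := by
    -- Conjugation by `x⁻¹` expresses level `j` through level `j + 1`, so the induction descends
    -- from the levels `j ≥ J`, which lie in `N`.
    have key : ∀ k j i, J ≤ j + k → x⁻¹ * iterComm x j (f i) * x ∈ H := by
      intro k
      induction k with
      | zero =>
        intro j i hj
        simpa using hN (Subgroup.Normal.conj_mem inferInstance _ (hJ i j hj) x⁻¹)
      | succ k ih =>
        intro j i hj
        have : x⁻¹ * iterComm x j (f i) * x =
            (x⁻¹ * iterComm x (j + 1) (f i) * x)⁻¹ * iterComm x j (f i) := by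
          simp [iterComm, commutatorElement_def, mul_assoc]
        rw [this]
        exact mul_mem (inv_mem (ih _ _ (by omega))) (hgen _ _)
    intro h hh
    simpa using hconj x⁻¹ (fun j i => by simpa using key J j i (by omega)) h hh
  have hx : Subgroup.zpowers x ≤ Subgroup.normalizer H := by
    rw [Subgroup.zpowers_le, Subgroup.mem_normalizer_iff]
    exact fun h => ⟨h1 h, fun hh => by simpa [mul_assoc] using h2 _ hh⟩
  have hle : Subgroup.closure S ⊔ N ≤ Subgroup.zpowers x ⊔ H := by
    refine sup_le ((Subgroup.closure_le _).mpr fun s hs => ?_) (hN.trans le_sup_right)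
    rcases hS s hs with rfl | ⟨i, rfl⟩
    · exact Subgroup.mem_sup_left (Subgroup.mem_zpowers s)
    · exact Subgroup.mem_sup_right (hgen 0 i)
  have hv' : v ∈ ((Subgroup.zpowers x ⊔ H : Subgroup G) : Set G) := hle hv
  rw [Subgroup.coe_mul_of_left_le_normalizer_right _ _ hx] at hv'
  obtain ⟨_, ⟨a, rfl⟩, v', hv', rfl⟩ := hv'
  exact ⟨a, v', hv', rfl⟩

/-- Modulo `γ_{c+1}`, taking `m`-th powers is multiplicative on `γ_c`. -/
theorem mul_pow_inv_mul_mem_gamma {c m : ℕ} (hc : 1 ≤ c) {u₁ u₂ v₁ v₂ : G}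
    (h₁ : u₁ ∈ gamma G c) (h₂ : u₂ ∈ gamma G c) (e₁ : (u₁ ^ m)⁻¹ * v₁ ∈ gamma G (c + 1))
    (e₂ : (u₂ ^ m)⁻¹ * v₂ ∈ gamma G (c + 1)) :
    ((u₁ * u₂) ^ m)⁻¹ * (v₁ * v₂) ∈ gamma G (c + 1) := by
  rw [← QuotientGroup.eq] at *
  have h : Commute (u₁ : G ⧸ gamma G (c + 1)) u₂ := by
    rw [← commutatorElement_eq_one_iff_commute]
    exact (QuotientGroup.eq_one_iff _).mpr
      (gamma_antitone G (by omega) (commutatorElement_mem_gamma hc hc h₁ h₂))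
  rw [QuotientGroup.mk_pow, QuotientGroup.mk_mul, h.mul_pow, ← QuotientGroup.mk_pow,
    ← QuotientGroup.mk_pow, e₁, e₂, QuotientGroup.mk_mul]

end Collection

/-! ### Magnus' theorem with coefficients modulo `m`. -/

section Core

variable {α : Type}

theorem Lead.iterComm {R : Type*} [CommRing R] {d e : ℕ} {x y : FreeGroup α}
    {a b : FreeAlgebra R α} (hx : Lead R d x a) (hy : Lead R e y b) (j : ℕ) :
    Lead R (j * d + e) (iterComm x j y) (iterAd a j b) := by
  induction j with
  | zero => simpa [AndreadakisOut.iterComm, iterAd] using hy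
  | succ j ih =>
    rw [show (j + 1) * d + e = d + (j * d + e) by ring]
    exact hx.commutator ih

/-- A weighted family in the free group whose leading Magnus coefficients freely generate
a subalgebra of the free associative algebra, over every ring. -/
structure FreeSystem {Y : Type} (wt : Y → ℕ) (f : Y → FreeGroup α) : Prop where
  one_le : ∀ y, 1 ≤ wt y
  mem_gamma : ∀ y, f y ∈ gamma (FreeGroup α) (wt y)
  finite : ∀ d, {y | wt y = d}.Finite
  lead : ∀ (R : Type) [CommRing R], ∃ b : Y → FreeAlgebra R α,
    (∀ y, Lead R (wt y) (f y) (b y)) ∧ Function.Injective (FreeAlgebra.lift R b)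

theorem freeSystem_of [Finite α] : FreeSystem (fun _ : α => 1) FreeGroup.of where
  one_le _ := le_rfl
  mem_gamma _ := Subgroup.mem_top _
  finite _ := Set.toFinite _
  lead R _ := ⟨FreeAlgebra.ι R, lead_of, by
    have : FreeAlgebra.lift R (FreeAlgebra.ι R) = AlgHom.id R (FreeAlgebra R α) := by ext; simp
    rw [this]
    exact Function.injective_id⟩

variable {Y : Type} {wt : Y → ℕ} {f : Y → FreeGroup α}

/-- The lift of the new coefficients is the old lift composed with the injection of Lazard
elimination. Finiteness in each weight holds because `(j, y)` has weight greater than `j`. -/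
theorem FreeSystem.eliminate (h : FreeSystem wt f) (x : Y) :
    FreeSystem (fun p : ℕ × {y // y ≠ x} => p.1 * wt x + wt p.2)
      (fun p => iterComm (f x) p.1 (f p.2)) where
  one_le p := (h.one_le p.2).trans (Nat.le_add_left _ _)
  mem_gamma p := iterComm_mem_gamma (h.one_le x) (h.one_le _) (h.mem_gamma x) (h.mem_gamma _) p.1
  finite d := by
    have h1 : (⋃ e ∈ Set.Iic d, {y | wt y = e}).Finite :=
      (Set.finite_Iic d).biUnion fun e _ => h.finite e
    refine ((Set.finite_Iic d).prod
      (h1.preimage (Subtype.val_injective (p := fun y => y ≠ x)).injOn)).subset ?_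
    rintro ⟨j, y⟩ hd
    have hd : j * wt x + wt y = d := hd
    have := Nat.le_mul_of_pos_right j (h.one_le x)
    simp only [Set.mem_prod, Set.mem_Iic, Set.mem_preimage, Set.mem_iUnion, Set.mem_ofPred_eq]
    exact ⟨by omega, _, by omega, rfl⟩
  lead R _ := by
    obtain ⟨b, hb, hinj⟩ := h.lead R
    refine ⟨fun p => iterAd (b x) p.1 (b p.2), fun p => (hb x).iterComm (hb _) p.1, ?_⟩
    have : FreeAlgebra.lift R (fun p : ℕ × {y // y ≠ x} => iterAd (b x) p.1 (b p.2)) =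
        (FreeAlgebra.lift R b).comp (FreeAlgebra.lift R fun p : ℕ × {y // y ≠ x} =>
          iterAd (FreeAlgebra.ι R x) p.1 (FreeAlgebra.ι R p.2.1)) := by
      refine FreeAlgebra.hom_ext (funext fun p => ?_)
      have h1 := map_iterAd (FreeAlgebra.lift R b).toRingHom (FreeAlgebra.ι R x) p.1
        (FreeAlgebra.ι R p.2.1)
      simpa using h1.symm
    rw [this]
    exact hinj.comp (lift_iterAd_injective R x)

/-- Elements of the subgroup obtained by eliminating a letter `x` of minimal weight `d` have
their coefficient of degree `d` in the span of the coefficients of the other letters. -/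
theorem exists_lead_mem_span (h : FreeSystem wt f) {R : Type} [CommRing R]
    {b : Y → FreeAlgebra R α} (hb : ∀ y, Lead R (wt y) (f y) (b y)) {x : Y}
    (hx : ∀ y, wt x ≤ wt y) {c : ℕ} (hc : wt x ≤ c) {v : FreeGroup α}
    (hv : v ∈ Subgroup.closure
      (Set.range fun p : ℕ × {y // y ≠ x} => iterComm (f x) p.1 (f p.2)) ⊔
        gamma (FreeGroup α) (c + 1)) :
    ∃ s ∈ Submodule.span R (b '' {y | y ≠ x}), Lead R (wt x) v s := by
  have hd := h.one_le x
  let K : Subgroup (FreeGroup α) :=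
    { carrier := {g | ∃ s ∈ Submodule.span R (b '' {y | y ≠ x}), Lead R (wt x) g s}
      mul_mem' := fun ⟨_, hs, ha⟩ ⟨_, ht, hb⟩ => ⟨_, add_mem hs ht, ha.mul hd hb⟩
      one_mem' := ⟨0, zero_mem _, lead_one _⟩
      inv_mem' := fun ⟨_, hs, ha⟩ => ⟨_, neg_mem hs, ha.inv⟩ }
  suffices hle : Subgroup.closure
      (Set.range fun p : ℕ × {y // y ≠ x} => iterComm (f x) p.1 (f p.2)) ⊔
        gamma (FreeGroup α) (c + 1) ≤ K from hle hv
  refine sup_le ((Subgroup.closure_le _).mpr ?_) fun g hg => ?_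
  -- By minimality of `wt x`, only letters with `j = 0` and `wt y = wt x` contribute in this degree.
  · rintro _ ⟨⟨j, y⟩, rfl⟩
    have h1 := (hb x).iterComm (hb y) j
    rcases (show wt x ≤ j * wt x + wt y from (hx y).trans (Nat.le_add_left _ _)).eq_or_lt
      with he | hlt
    · have hj : j = 0 := by
        by_contra hj
        have := Nat.le_mul_of_pos_left (wt x) (Nat.pos_of_ne_zero hj)
        have := h.one_le y
        omega
      subst hj
      rw [← he] at h1
      exact ⟨b y, Submodule.subset_span ⟨y, y.2, rfl⟩, h1⟩
    · exact ⟨0, zero_mem _, h1.zero_of_lt hlt⟩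
  · obtain ⟨a, ha⟩ := exists_lead_of_mem_gamma (R := R) (by omega) hg
    exact ⟨0, zero_mem _, ha.zero_of_lt (by omega)⟩

theorem FreeSystem.smul_eq_zero {R : Type} [CommRing R]
    {b : Y → FreeAlgebra R α} (hinj : Function.Injective (FreeAlgebra.lift R b)) {x : Y} {r : R}
    {s : FreeAlgebra R α} (hs : s ∈ Submodule.span R (b '' {y | y ≠ x}))
    (h : r • b x + s = 0) : r = 0 := by
  have hb : b '' {y | y ≠ x} =
      (FreeAlgebra.lift R b).toLinearMap '' (FreeAlgebra.ι R '' {y | y ≠ x}) := by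
    rw [Set.image_image]
    simp
  rw [hb, ← Submodule.map_span] at hs
  obtain ⟨s, hs, rfl⟩ := hs
  refine eq_zero_of_smul_ι_add_eq_zero R hs (hinj ?_)
  simpa using h

/-- If the Magnus coefficient of degree `c` of `v ∈ γ_c` vanishes modulo `m`, then `v` is an
`m`-th power modulo `γ_{c+1}`, for `v` in the subgroup generated by a free system. -/
theorem FreeSystem.exists_pow {c m : ℕ} (hc : 1 ≤ c) {e k : ℕ} (h : FreeSystem wt f)
    (hwt : ∀ y, c + 1 ≤ wt y + e) (hk : {y | wt y + e = c + 1}.ncard = k) {v : FreeGroup α}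
    (hv : v ∈ Subgroup.closure (Set.range f) ⊔ gamma (FreeGroup α) (c + 1))
    (hvc : v ∈ gamma (FreeGroup α) c) (hlead : Lead (ZMod m) c v 0) :
    ∃ u ∈ gamma (FreeGroup α) c, (u ^ m)⁻¹ * v ∈ gamma (FreeGroup α) (c + 1) := by
  -- All weights are at least `c + 1 - e`, and `k` counts the letters of exactly that weight.
  -- Eliminating one of them lowers `k`; once none is left, `e` drops. At `e = 0` all letters lie in
  -- `γ_{c+1}`.
  induction e generalizing Y k v with
  | zero =>
    have hle : Subgroup.closure (Set.range f) ⊔ gamma (FreeGroup α) (c + 1) ≤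
        gamma (FreeGroup α) (c + 1) := by
      refine sup_le ((Subgroup.closure_le _).mpr ?_) le_rfl
      rintro _ ⟨y, rfl⟩
      exact gamma_antitone _ (hwt y) (h.mem_gamma y)
    exact ⟨1, one_mem _, by simpa using hle hv⟩
  | succ e ihe =>
    induction k generalizing Y v with
    | zero =>
      -- Finiteness is essential: `Set.ncard` is also `0` on infinite sets.
      have hfin : {y | wt y + (e + 1) = c + 1}.Finite :=
        (h.finite (c - e)).subset fun y hy => by
          have hy : wt y + (e + 1) = c + 1 := hy
          change wt y = c - e
          omega
      refine ihe h (fun y => ?_) rfl hv hvc hlead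
      have h1 := hwt y
      have h2 : y ∉ {y | wt y + (e + 1) = c + 1} := by
        rw [(Set.ncard_eq_zero hfin).mp hk]
        exact Set.notMem_empty y
      have h2 : ¬ wt y + (e + 1) = c + 1 := h2
      omega
    | succ k ihk =>
      obtain ⟨x, hxm⟩ := Set.nonempty_of_ncard_ne_zero (hk.trans_ne k.succ_ne_zero)
      have hx : wt x + (e + 1) = c + 1 := hxm
      have hd := h.one_le x
      have hmin : ∀ y, wt x ≤ wt y := fun y => by have := hwt y; omega
      have hdc : wt x ≤ c := by omega
      have h' := h.eliminate x
      have hwt' : ∀ p : ℕ × {y // y ≠ x}, c + 1 ≤ p.1 * wt x + wt p.2 + (e + 1) := fun p => by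
        have := hwt p.2
        omega
      have hk' : {p : ℕ × {y // y ≠ x} | p.1 * wt x + wt p.2 + (e + 1) = c + 1}.ncard = k := by
        -- A letter with `j ≥ 1` is strictly heavier than the minimum, so the lightest new letters
        -- are the old ones other than `x`.
        have h1 : ((fun p : ℕ × {y // y ≠ x} => (p.2 : Y)) ''
            {p : ℕ × {y // y ≠ x} | p.1 * wt x + wt p.2 + (e + 1) = c + 1}) =
            {y | wt y + (e + 1) = c + 1} \ {x} := by
          ext y
          constructor
          · rintro ⟨⟨j, y⟩, hp, rfl⟩
            have hp : j * wt x + wt y + (e + 1) = c + 1 := hp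
            have := hwt y
            exact ⟨show wt y + (e + 1) = c + 1 by omega, y.2⟩
          · rintro ⟨hy, hyx⟩
            exact ⟨(0, ⟨y, hyx⟩), by simpa using hy, rfl⟩
        rw [← Set.InjOn.ncard_image (f := fun p : ℕ × {y // y ≠ x} => (p.2 : Y)), h1,
          Set.ncard_sdiff_singleton_of_mem hxm, hk, Nat.add_sub_cancel]
        rintro ⟨j, y⟩ hp ⟨j', y'⟩ hp' hyy
        have hp : j * wt x + wt y + (e + 1) = c + 1 := hp
        have hp' : j' * wt x + wt y' + (e + 1) = c + 1 := hp'
        have h2 := hwt y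
        have h3 := hwt y'
        have h4 : j * wt x = 0 := by omega
        have h5 : j' * wt x = 0 := by omega
        have h6 : wt x ≠ 0 := by omega
        have h7 : j = j' := by simp_all
        exact Prod.ext h7 (Subtype.ext hyy)
      obtain ⟨a, v', hv', rfl⟩ := mem_zpowers_mul (N := gamma (FreeGroup α) (c + 1)) (x := f x)
        (f := fun y : {y // y ≠ x} => f y) (J := c)
        (fun y j hj => gamma_antitone _ (by
          have := Nat.le_mul_of_pos_right j (h.one_le x)
          have := h.one_le y
          omega) (iterComm_mem_gamma (h.one_le x) (h.one_le y) (h.mem_gamma x) (h.mem_gamma y) j))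
        (S := Set.range f) (by
          rintro _ ⟨y, rfl⟩
          by_cases hy : y = x
          · exact Or.inl (by rw [hy])
          · exact Or.inr ⟨⟨y, hy⟩, rfl⟩) hv
      -- Below degree `c` the integral coefficient of `v` vanishes, so independence over `ℤ` forces
      -- the exponent `a` to be `0`. In degree `c` independence over `ZMod m` gives only `m ∣ a`, so
      -- `f x ^ a` is an `m`-th power and the induction treats `v'`.
      rcases hdc.lt_or_eq with hlt | heq
      · obtain ⟨b, hb, hinj⟩ := h.lead ℤ
        obtain ⟨s, hs, hs'⟩ := exists_lead_mem_span h hb hmin hdc hv'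
        obtain ⟨a', ha'⟩ := exists_lead_of_mem_gamma (R := ℤ) hc hvc
        have h1 := (((hb x).zpow hd a).mul hd hs').unique hd (ha'.zero_of_lt hlt)
        have h2 := FreeSystem.smul_eq_zero hinj hs h1
        subst h2
        rw [zpow_zero, one_mul] at hvc hlead ⊢
        exact ihk h' hwt' hk' hv' hvc hlead
      · obtain ⟨b, hb, hinj⟩ := h.lead (ZMod m)
        obtain ⟨s, hs, hs'⟩ := exists_lead_mem_span h hb hmin hdc hv'
        rw [← heq] at hlead hvc
        have h1 := (((hb x).zpow hd a).mul hd hs').unique hd hlead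
        rw [← Int.cast_smul_eq_zsmul (ZMod m)] at h1
        have h2 := FreeSystem.smul_eq_zero hinj hs h1
        rw [h2, zero_smul, zero_add] at h1
        subst h1
        have hxc : f x ^ a ∈ gamma (FreeGroup α) (wt x) := zpow_mem (h.mem_gamma x) a
        have hvc' := (Subgroup.mul_mem_cancel_left _ hxc).mp hvc
        rw [heq] at hvc' hs' hxc
        obtain ⟨u, hu, hu'⟩ := ihk h' hwt' hk' hv' hvc' hs'
        obtain ⟨q, rfl⟩ := (ZMod.intCast_zmod_eq_zero_iff_dvd a m).mp h2
        refine ⟨f x ^ q * u, mul_mem (zpow_mem (heq ▸ h.mem_gamma x) q) hu,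
          mul_pow_inv_mul_mem_gamma hc (zpow_mem (heq ▸ h.mem_gamma x) q) hu ?_ hu'⟩
        rw [mul_comm, zpow_mul, zpow_natCast, inv_mul_cancel]
        exact one_mem _

/-- If the Magnus coefficient of degree `c` of `v ∈ γ_c` vanishes modulo `m`, then `v` is an
`m`-th power modulo `γ_{c+1}`. -/
theorem exists_pow_of_lead_zmod [Finite α] {c : ℕ} (m : ℕ) (hc : 1 ≤ c) {v : FreeGroup α}
    (hvc : v ∈ gamma (FreeGroup α) c) (hlead : Lead (ZMod m) c v 0) :
    ∃ u ∈ gamma (FreeGroup α) c, (u ^ m)⁻¹ * v ∈ gamma (FreeGroup α) (c + 1) := by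
  refine (freeSystem_of (α := α)).exists_pow hc (e := c) (fun _ => by omega) rfl ?_ hvc hlead
  rw [FreeGroup.closure_range_of, top_sup_eq]
  exact Subgroup.mem_top v

/-- Magnus' theorem. -/
theorem mem_gamma_succ_of_lead [Finite α] {c : ℕ} (hc : 1 ≤ c) {v : FreeGroup α}
    (hvc : v ∈ gamma (FreeGroup α) c) (hlead : Lead ℤ c v 0) :
    v ∈ gamma (FreeGroup α) (c + 1) := by
  -- `ZMod 0` is `ℤ`, and `u ^ 0 = 1`.
  obtain ⟨u, -, hu⟩ := exists_pow_of_lead_zmod 0 hc hvc hlead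
  simpa using hu

end Core

/-! ### Centralizers, change of coefficients and homogeneity in the free algebra. -/

section Coefficients

variable {R : Type*} [CommRing R] {α : Type*}

/-- An element without constant term of a free associative algebra of rank at least two which
commutes with all generators is zero. -/
theorem eq_zero_of_commute_ι [Nontrivial α] {a : FreeAlgebra R α}
    (h0 : FreeAlgebra.algebraMapInv a = 0) (h : ∀ i, Commute (FreeAlgebra.ι R i) a) : a = 0 := by
  let e := FreeAlgebra.equivMonoidAlgebraFreeMonoid (R := R) (X := α)
  have he : ∀ i, e (FreeAlgebra.ι R i) = MonoidAlgebra.single (FreeMonoid.of i) 1 := fun i => by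
    simp [e, FreeAlgebra.equivMonoidAlgebraFreeMonoid, MonoidAlgebra.of]
  have hw : ∀ w : FreeMonoid α, w ≠ 1 → (e a).coeff w = 0 := by
    intro w hw
    cases w using FreeMonoid.casesOn with
    | one => exact absurd rfl hw
    | of_mul i w =>
      obtain ⟨j, hj⟩ := exists_ne i
      have h1 := congrArg e (h j).eq
      rw [map_mul, map_mul, he] at h1
      -- Compare the coefficients of the word `i w j` in `x_j a = a x_j`. On the left it is `0`, as
      -- the word starts with `i ≠ j`; on the right it is the coefficient of `i w` in `a`.
      have h2 := DFunLike.congr_fun (congrArg MonoidAlgebra.coeff h1)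
        (FreeMonoid.of i * w * FreeMonoid.of j)
      rw [MonoidAlgebra.coeff_single_mul_of_forall_mul_ne,
        MonoidAlgebra.coeff_mul_single_eq_coeff_mul (FreeMonoid.of i * w)
          (fun _ _ => mul_left_inj _), mul_one] at h2
      · exact h2.symm
      · intro d hd
        rw [mul_assoc] at hd
        have h3 := congrArg FreeMonoid.toList hd
        simp only [FreeMonoid.toList_mul, FreeMonoid.toList_of, List.singleton_append,
          List.cons.injEq] at h3
        exact hj h3.1
  have h4 : e a = algebraMap R _ ((e a).coeff 1) := by
    ext w
    by_cases hw1 : w = 1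
    · subst hw1
      simp
    · simp [hw w hw1, Ne.symm hw1]
  have h5 : a = algebraMap R _ ((e a).coeff 1) := by
    apply e.injective
    rw [AlgEquiv.commutes]
    exact h4
  rw [h5] at h0 ⊢
  rw [AlgHom.commutes] at h0
  simp only [Algebra.algebraMap_self, RingHom.id_apply] at h0
  rw [h0, map_zero]

theorem Lead.map {S : Type*} [CommRing S] (φ : FreeAlgebra R α →+* FreeAlgebra S α)
    (hφ : ∀ i, φ (FreeAlgebra.ι R i) = FreeAlgebra.ι S i) {k : ℕ} {g : FreeGroup α}
    {a : FreeAlgebra R α} (h : Lead R k g a) : Lead S k g (φ a) := by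
  have h1 : (Units.map (PowerSeries.map φ).toMonoidHom).comp (magnus R) =
      (magnus S : FreeGroup α →* _) := by
    ext i : 2
    simp [magnus, onePlusUnit, hφ]
  obtain ⟨q, hq, rfl⟩ := h
  refine ⟨PowerSeries.map φ q, ?_, by
    rw [← coeff_zero_eq_constantCoeff_apply, coeff_map, coeff_zero_eq_constantCoeff_apply]⟩
  rw [← h1]
  simp [hq]

variable (R α) in
/-- The homogeneous elements of degree `k` of the free associative algebra. -/
noncomputable def homog (k : ℕ) : Submodule R (FreeAlgebra R α) :=
  (Submodule.span R (Set.range (FreeAlgebra.ι R))) ^ k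

instance [Finite α] (k : ℕ) : Module.Finite R (homog R α k) :=
  Module.Finite.iff_fg.mpr ((Submodule.fg_span (Set.finite_range _)).pow k)

/-- This places leading coefficients in a finitely generated module, the source of finite generation
for the quotients of the filtrations. -/
theorem coeff_magnus_mem_homog (g : FreeGroup α) (k : ℕ) :
    coeff k (magnus R g : (FreeAlgebra R α)⟦X⟧) ∈ homog R α k := by
  have hι : ∀ i, FreeAlgebra.ι R i ∈ Submodule.span R (Set.range (FreeAlgebra.ι R (X := α))) :=
    fun i => Submodule.subset_span ⟨i, rfl⟩
  induction g using FreeGroup.induction_on generalizing k with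
  | C1 =>
    rw [map_one, Units.val_one, coeff_one]
    split_ifs with h
    · subst h
      exact Submodule.one_le.mp (pow_zero _).ge
    · exact zero_mem _
  | of i =>
    simp only [magnus, FreeGroup.lift_apply_of, onePlusUnit, map_add, coeff_one]
    refine add_mem ?_ ?_
    · split_ifs with h
      · subst h
        exact Submodule.one_le.mp (pow_zero _).ge
      · exact zero_mem _
    · cases k with
      | zero => simp
      | succ k =>
        rw [coeff_succ_mul_X, coeff_C]
        split_ifs with h
        · subst h
          simpa [homog] using hι i
        · exact zero_mem _
  | inv_of i =>
    simp only [magnus, map_inv, FreeGroup.lift_apply_of]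
    change coeff k (PowerSeries.mk fun n => (-FreeAlgebra.ι R i) ^ n) ∈ _
    rw [coeff_mk]
    exact Submodule.pow_mem_pow _ (neg_mem (hι i)) k
  | mul x y hx hy =>
    rw [map_mul, Units.val_mul, coeff_mul]
    refine sum_mem fun p hp => ?_
    rw [← Finset.HasAntidiagonal.mem_antidiagonal.mp hp, homog, pow_add]
    exact Submodule.mul_mem_mul (hx _) (hy _)

theorem Lead.mem_homog {k : ℕ} (hk : 1 ≤ k) {g : FreeGroup α} {a : FreeAlgebra R α}
    (h : Lead R k g a) : a ∈ homog R α k := h.coeff_eq hk ▸ coeff_magnus_mem_homog g k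

theorem algebraMapInv_eq_zero_of_mem_homog {k : ℕ} (hk : 1 ≤ k) {a : FreeAlgebra R α}
    (h : a ∈ homog R α k) : FreeAlgebra.algebraMapInv a = 0 := by
  have h1 : Submodule.span R (Set.range (FreeAlgebra.ι R (X := α))) ≤
      (FreeAlgebra.algebraMapInv (R := R) (X := α)).toLinearMap.ker := by
    rw [Submodule.span_le]
    rintro _ ⟨i, rfl⟩
    simp [FreeAlgebra.algebraMapInv]
  obtain ⟨k, rfl⟩ := Nat.exists_eq_add_of_le' hk
  rw [homog, pow_succ] at h
  induction h using Submodule.mul_induction_on' with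
  | mem_mul_mem x _ y hy => rw [map_mul, show FreeAlgebra.algebraMapInv y = 0 from h1 hy, mul_zero]
  | add x _ y _ hx hy => rw [map_add, hx, hy, add_zero]

end Coefficients

/-! ### A criterion for being free abelian. -/

section FreeAbelian

theorem isFreeAbelian_of_fg {A : Type} [Group A] (hcomm : ∀ a b : A, a * b = b * a)
    (hfg : Group.FG A) (htf : ∀ (a : A) (m : ℕ), m ≠ 0 → a ^ m = 1 → a = 1) :
    IsFreeAbelian A := by
  let _ : CommGroup A := { ‹Group A› with mul_comm := hcomm }
  have : Module.Finite ℤ (Additive A) := Module.Finite.iff_addGroup_fg.mpr inferInstance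
  have : IsAddTorsionFree (Additive A) := ⟨fun m hm a b hab => by
    have h : (a.toMul / b.toMul) ^ m = 1 := by
      rw [div_pow, div_eq_one]
      exact congrArg Additive.toMul hab
    exact Additive.toMul.injective (div_eq_one.mp (htf _ m hm h))⟩
  let e := (Module.finBasis ℤ (Additive A)).repr.toAddEquiv.trans
    (FreeAbelianGroup.equivFinsupp _).symm
  exact ⟨_, ⟨{ toEquiv := Additive.ofMul.trans (e.toEquiv.trans Multiplicative.ofAdd)
               map_mul' := fun a b => e.map_add _ _ }⟩⟩

/-- `φ` embeds `G ⧸ N` in `M`; finite generation passes to the image because `ℤ` is Noetherian. -/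
theorem quotient_fg_torsionFree {G M : Type} [Group G] {N : Subgroup G} [N.Normal]
    [AddCommGroup M] [inst : Module ℤ M] [Module.Finite ℤ M] [Module.IsTorsionFree ℤ M]
    (φ : G →* Multiplicative M) (hφ : ∀ g, φ g = 1 ↔ g ∈ N) :
    (∀ a b : G ⧸ N, a * b = b * a) ∧ Group.FG (G ⧸ N) ∧
      ∀ (a : G ⧸ N) (m : ℕ), m ≠ 0 → a ^ m = 1 → a = 1 := by
  obtain rfl : inst = AddCommGroup.toIntModule M := Subsingleton.elim _ _
  have : IsAddTorsionFree M := .of_isTorsionFree ℤ M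
  let ψ : G ⧸ N →* Multiplicative M := QuotientGroup.lift N φ fun g hg => (hφ g).mpr hg
  have hψ : Function.Injective ψ := by
    rw [injective_iff_map_eq_one]
    intro a ha
    induction a using QuotientGroup.induction_on with
    | H g => exact (QuotientGroup.eq_one_iff g).mpr ((hφ g).mp ha)
  have hcomm : ∀ a b : G ⧸ N, a * b = b * a := fun a b => hψ (by
    rw [map_mul, map_mul, mul_comm])
  refine ⟨hcomm, ?_, fun a m hm ha => hψ ?_⟩
  · let _ : CommGroup (G ⧸ N) := { (inferInstance : Group (G ⧸ N)) with mul_comm := hcomm }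
    let l : Additive (G ⧸ N) →ₗ[ℤ] M := (MonoidHom.toAdditiveLeft ψ).toIntLinearMap
    have : Module.Finite ℤ (Additive (G ⧸ N)) := Module.Finite.of_injective l hψ
    exact GroupFG.iff_add_fg.mpr (Module.Finite.iff_addGroup_fg.mp this)
  · have h := congrArg ψ ha
    rw [map_pow, map_one] at h
    rw [map_one]
    exact pow_left_injective hm (by simpa using h)

end FreeAbelian

/-! ### The Johnson homomorphism and inner automorphisms. -/

section Johnson

variable {α : Type}

/-- The leading Magnus coefficient as a homomorphism on `γ_c`. -/
noncomputable def leadHom (α : Type) (c : ℕ) (hc : 1 ≤ c) :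
    gamma (FreeGroup α) c →* Multiplicative (homog ℤ α c) where
  toFun g := Multiplicative.ofAdd
    ⟨coeff c (magnus ℤ (g : FreeGroup α) : (FreeAlgebra ℤ α)⟦X⟧), coeff_magnus_mem_homog _ _⟩
  map_one' := by
    refine congrArg Multiplicative.ofAdd (Subtype.ext ?_)
    exact (lead_one c).coeff_eq hc
  map_mul' g h := by
    refine congrArg Multiplicative.ofAdd (Subtype.ext ?_)
    obtain ⟨a, ha⟩ := exists_lead_of_mem_gamma (R := ℤ) hc g.2
    obtain ⟨b, hb⟩ := exists_lead_of_mem_gamma (R := ℤ) hc h.2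
    change _ = coeff c _ + coeff c _
    rw [ha.coeff_eq hc, hb.coeff_eq hc]
    exact (ha.mul hc hb).coeff_eq hc

theorem leadHom_eq_iff {c : ℕ} (hc : 1 ≤ c) {g : gamma (FreeGroup α) c} {a : homog ℤ α c} :
    leadHom α c hc g = Multiplicative.ofAdd a ↔ Lead ℤ c (g : FreeGroup α) a := by
  obtain ⟨b, hb⟩ := exists_lead_of_mem_gamma (R := ℤ) hc g.2
  have h : leadHom α c hc g = Multiplicative.ofAdd ⟨b, hb.mem_homog hc⟩ :=
    congrArg Multiplicative.ofAdd (Subtype.ext (hb.coeff_eq hc))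
  rw [h, Multiplicative.ofAdd.apply_eq_iff_eq, Subtype.ext_iff]
  exact ⟨fun e => e ▸ hb, fun e => hb.unique hc e⟩

theorem leadHom_eq_one_iff [Finite α] {c : ℕ} (hc : 1 ≤ c) {g : gamma (FreeGroup α) c} :
    leadHom α c hc g = 1 ↔ (g : FreeGroup α) ∈ gamma (FreeGroup α) (c + 1) := by
  change _ = Multiplicative.ofAdd 0 ↔ _
  rw [leadHom_eq_iff]
  refine ⟨fun h => mem_gamma_succ_of_lead hc g.2 h, fun h => ?_⟩
  obtain ⟨b, hb⟩ := exists_lead_of_mem_gamma (R := ℤ) (by omega) h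
  exact hb.zero_of_lt (Nat.lt_succ_self c)

theorem andreadakis_antitone (F : Type*) [Group F] : Antitone (andreadakis F) :=
  antitone_nat_of_succ_le (andreadakis_succ_le F)

/-- An automorphism acting trivially on the abelianization acts trivially on `γ_k / γ_{k+1}`. -/
theorem inv_mul_apply_mem_gamma {F : Type*} [Group F] {ψ : MulAut F} (hψ : ψ ∈ andreadakis F 1)
    {k : ℕ} (hk : 1 ≤ k) {u : F} (hu : u ∈ gamma F k) : u⁻¹ * ψ u ∈ gamma F (k + 1) := by
  rw [mem_andreadakis_iff] at hψ
  induction k, hk using Nat.le_induction generalizing u with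
  | base => exact hψ u
  | succ k hk ih =>
    let q := QuotientGroup.mk' (gamma F (k + 1 + 1))
    have hcomm : ∀ {i j : ℕ} {x y : F}, 1 ≤ i → 1 ≤ j → k + 1 + 1 ≤ i + j → x ∈ gamma F i →
        y ∈ gamma F j → Commute (q x) (q y) := by
      intro i j x y hi hj hij hx hy
      rw [← commutatorElement_eq_one_iff_commute, ← map_commutatorElement]
      exact (QuotientGroup.eq_one_iff _).mpr
        (gamma_antitone F hij (commutatorElement_mem_gamma hi hj hx hy))
    -- The elements fixed modulo `γ_{k+2}` form a subgroup, so commutators suffice. In `⁅a * a', b *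
    -- b'⁆`, modulo `γ_{k+2}`, `a'` commutes with `b` and `b'`, and `b'` commutes with `a`, so both
    -- corrections cancel.
    suffices h : gamma F (k + 1) ≤ MonoidHom.eqLocus (q.comp ψ.toMonoidHom) q from
      QuotientGroup.eq.mp (h hu).symm
    rw [gamma_succ F k hk, Subgroup.commutator_le]
    intro a ha b _
    obtain ⟨a', ha', hψa⟩ : ∃ a' ∈ gamma F (k + 1), ψ a = a * a' := ⟨_, ih ha, by simp⟩
    obtain ⟨b', hb', hψb⟩ : ∃ b' ∈ gamma F 2, ψ b = b * b' := ⟨_, hψ b, by simp⟩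
    change q (ψ ⁅a, b⁆) = q ⁅a, b⁆
    have h1 : Commute (q a') (q b) :=
      hcomm (i := k + 1) (j := 1) (by omega) le_rfl le_rfl ha' (Subgroup.mem_top _)
    have h2 : Commute (q a') (q b') :=
      hcomm (i := k + 1) (j := 1) (by omega) le_rfl le_rfl ha' (Subgroup.mem_top _)
    have h3 : Commute (q a) (q b') := hcomm hk (by omega) le_rfl ha hb'
    rw [map_commutatorElement, hψa, hψb, map_commutatorElement, map_commutatorElement, map_mul,
      map_mul, commutatorElement_def, commutatorElement_def]
    have h4 : q a * q a' * (q b * q b') = q a * q b * q b' * q a' := by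
      rw [mul_assoc, ← mul_assoc (q a'), h1.eq, mul_assoc (q b), h2.eq]
      group
    have h5 : q b' * (q a)⁻¹ = (q a)⁻¹ * q b' := h3.inv_left.eq.symm
    calc q a * q a' * (q b * q b') * (q a * q a')⁻¹ * (q b * q b')⁻¹
        = q a * q b * (q b' * (q a)⁻¹) * (q b')⁻¹ * (q b)⁻¹ := by rw [h4]; group
      _ = q a * q b * (q a)⁻¹ * (q b)⁻¹ := by rw [h5]; group

/-- The Johnson homomorphism on `G_c`: the leading Magnus coefficients of `x⁻¹ ψ(x)` for the
generators `x`. -/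
noncomputable def johnson (α : Type) (c : ℕ) (hc : 1 ≤ c) :
    andreadakis (FreeGroup α) c →* Multiplicative (α → homog ℤ α (c + 1)) where
  toFun ψ := Multiplicative.ofAdd fun i => Multiplicative.toAdd (leadHom α (c + 1) (by omega)
    ⟨(FreeGroup.of i)⁻¹ * ψ.1 (FreeGroup.of i), mem_andreadakis_iff.mp ψ.2 _⟩)
  map_one' := by
    refine congrArg Multiplicative.ofAdd (funext fun i => ?_)
    refine congrArg Multiplicative.toAdd ((congrArg _ (Subtype.ext ?_)).trans (map_one _))
    simp
  map_mul' ψ φ := by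
    refine congrArg Multiplicative.ofAdd (funext fun i => ?_)
    set x := FreeGroup.of i
    have hu : x⁻¹ * φ.1 x ∈ gamma (FreeGroup α) (c + 1) := mem_andreadakis_iff.mp φ.2 _
    have hw := inv_mul_apply_mem_gamma (andreadakis_antitone _ hc ψ.2) (by omega) hu
    have hw' : leadHom α (c + 1) (by omega) ⟨_, gamma_succ_le _ _ hw⟩ = Multiplicative.ofAdd 0 := by
      obtain ⟨b, hb⟩ := exists_lead_of_mem_gamma (R := ℤ) (by omega) hw
      exact (leadHom_eq_iff _).mpr (hb.zero_of_lt (Nat.lt_succ_self _))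
    rw [ofAdd_zero] at hw'
    -- With `u = x⁻¹ φ(x)`, one has `x⁻¹ ψ(φ(x)) = (x⁻¹ ψ(x)) u (u⁻¹ ψ(u))`, and the last factor
    -- lies one step deeper.
    refine congrArg Multiplicative.toAdd (Eq.trans (b := leadHom α (c + 1) (by omega)
      (⟨x⁻¹ * ψ.1 x, mem_andreadakis_iff.mp ψ.2 _⟩ * (⟨x⁻¹ * φ.1 x, hu⟩ *
        ⟨_, gamma_succ_le _ _ hw⟩))) ?_ ?_)
    · refine congrArg _ (Subtype.ext ?_)
      simp [mul_assoc]
    · rw [map_mul, map_mul, hw', mul_one]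
      rfl

theorem johnson_apply {c : ℕ} (hc : 1 ≤ c) (ψ : andreadakis (FreeGroup α) c) (i : α) :
    Lead ℤ (c + 1) ((FreeGroup.of i)⁻¹ * ψ.1 (FreeGroup.of i))
      (Multiplicative.toAdd (johnson α c hc ψ) i : FreeAlgebra ℤ α) :=
  (leadHom_eq_iff (by omega)
    (g := ⟨(FreeGroup.of i)⁻¹ * ψ.1 (FreeGroup.of i), mem_andreadakis_iff.mp ψ.2 _⟩)).mp rfl

/-- By Magnus' theorem, a trivial value means that `ψ` fixes the generators modulo `γ_{c+2}`, hence
fixes everything modulo `γ_{c+2}`. -/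
theorem johnson_eq_one_iff [Finite α] {c : ℕ} (hc : 1 ≤ c) (ψ : andreadakis (FreeGroup α) c) :
    johnson α c hc ψ = 1 ↔ ψ ∈ (andreadakis (FreeGroup α) (c + 1)).subgroupOf
      (andreadakis (FreeGroup α) c) := by
  have h1 : johnson α c hc ψ = 1 ↔ ∀ i, (FreeGroup.of i)⁻¹ * ψ.1 (FreeGroup.of i) ∈
      gamma (FreeGroup α) (c + 1 + 1) := by
    refine Iff.trans ?_ (forall_congr' fun i => leadHom_eq_one_iff (by omega)
      (g := ⟨_, mem_andreadakis_iff.mp ψ.2 (FreeGroup.of i)⟩))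
    exact funext_iff
  rw [h1, Subgroup.mem_subgroupOf, mem_andreadakis_iff]
  refine ⟨fun h x => ?_, fun h i => h _⟩
  let q := QuotientGroup.mk' (gamma (FreeGroup α) (c + 1 + 1))
  have h2 : q = q.comp ψ.1.toMonoidHom := by
    ext i
    exact QuotientGroup.eq.mpr (h i)
  exact QuotientGroup.eq.mp (DFunLike.congr_fun h2 x)

/-- The centre of the free Lie ring modulo `m` is trivial: if all commutators of `y ∈ γ_k` with
generators have vanishing leading coefficient modulo `m`, then `y` is an `m`-th power modulo
`γ_{k+1}`. -/
theorem exists_pow_of_commutator_lead [Finite α] [Nontrivial α] {k : ℕ} (m : ℕ) (hk : 1 ≤ k)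
    {y : FreeGroup α} (hy : y ∈ gamma (FreeGroup α) k)
    (h : ∀ i, Lead (ZMod m) (k + 1) ⁅(FreeGroup.of i : FreeGroup α)⁻¹, y⁆ 0) :
    ∃ u ∈ gamma (FreeGroup α) k, (u ^ m)⁻¹ * y ∈ gamma (FreeGroup α) (k + 1) := by
  obtain ⟨a, ha⟩ := exists_lead_of_mem_gamma (R := ZMod m) hk hy
  have h1 : a = 0 := by
    refine eq_zero_of_commute_ι (algebraMapInv_eq_zero_of_mem_homog hk (ha.mem_homog hk))
      fun i => ?_
    have h2 := ((lead_of i).inv.commutator ha).unique (by omega) (add_comm k 1 ▸ h i)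
    rw [neg_mul, mul_neg, sub_neg_eq_add, neg_add_eq_zero] at h2
    exact h2
  exact exists_pow_of_lead_zmod m hk hy (h1 ▸ ha)

theorem inv_mul_conj_apply {F : Type*} [Group F] (x y : F) :
    x⁻¹ * MulAut.conj y x = ⁅x⁻¹, y⁆ := by
  simp [MulAut.conj_apply, commutatorElement_def, mul_assoc]

/-- Conjugation by `y` lies in `G_c` only if `y ∈ γ_c`. -/
theorem mem_gamma_of_conj_mem [Finite α] [Nontrivial α] {c : ℕ} (hc : 1 ≤ c) {y : FreeGroup α}
    (h : MulAut.conj y ∈ andreadakis (FreeGroup α) c) : y ∈ gamma (FreeGroup α) c := by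
  induction c, hc using Nat.le_induction with
  | base => exact Subgroup.mem_top _
  | succ c hc ih =>
    -- The commutators of `y` with generators lie in `γ_{c+2}`, so their coefficients of degree `c +
    -- 1` vanish; `m = 0` then gives `y ∈ γ_{c+1}`.
    obtain ⟨u, -, hu⟩ := exists_pow_of_commutator_lead 0 hc (ih (andreadakis_succ_le _ c h))
      fun i => by
        have h1 := mem_andreadakis_iff.mp h (FreeGroup.of i)
        rw [inv_mul_conj_apply] at h1
        obtain ⟨b, hb⟩ := exists_lead_of_mem_gamma (R := ZMod 0) (by omega) h1
        exact hb.zero_of_lt (Nat.lt_succ_self _)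
    simpa using hu

/-- The kernel of `G_c → H_c / H_{c+1}` is `ad(γ_c) G_{c+1}`. -/
theorem proj_mem_outFiltration_iff [Finite α] [Nontrivial α] {c : ℕ} (hc : 1 ≤ c)
    {ψ : MulAut (FreeGroup α)} (hψ : ψ ∈ andreadakis (FreeGroup α) c) :
    proj (FreeGroup α) ψ ∈ outFiltration (FreeGroup α) (c + 1) ↔
      ∃ y ∈ gamma (FreeGroup α) c,
        (MulAut.conj y)⁻¹ * ψ ∈ andreadakis (FreeGroup α) (c + 1) := by
  constructor
  · rintro ⟨φ, hφ, h⟩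
    obtain ⟨y, hy⟩ : φ⁻¹ * ψ ∈ inner (FreeGroup α) := QuotientGroup.eq.mp h
    have hφ : φ ∈ andreadakis (FreeGroup α) (c + 1) := hφ
    refine ⟨y, mem_gamma_of_conj_mem hc ?_, ?_⟩
    · rw [hy]
      exact mul_mem (inv_mem (andreadakis_succ_le _ c hφ)) hψ
    -- Here `(MulAut.conj y)⁻¹ * ψ = ψ⁻¹ * φ * ψ`, so normality of `G_{c+1}` applies.
    · rw [hy, mul_inv_rev, inv_inv, mul_assoc]
      simpa [mul_assoc] using Subgroup.Normal.conj_mem inferInstance φ hφ ψ⁻¹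
  · rintro ⟨y, -, h⟩
    refine ⟨_, h, ?_⟩
    have hy : proj (FreeGroup α) (MulAut.conj y) = 1 := (QuotientGroup.eq_one_iff _).mpr ⟨y, rfl⟩
    rw [map_mul, map_inv, hy, inv_one, one_mul]

theorem map_nsmul_homog_eq_zero {k m : ℕ} (φ : FreeAlgebra ℤ α →+* FreeAlgebra (ZMod m) α)
    (a : homog ℤ α k) : φ ((m • a : homog ℤ α k) : FreeAlgebra ℤ α) = 0 := by
  let χ : homog ℤ α k →+ FreeAlgebra (ZMod m) α :=
    φ.toAddMonoidHom.comp (homog ℤ α k).subtype.toAddMonoidHom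
  change χ (m • a) = 0
  rw [map_nsmul, ← Nat.cast_smul_eq_nsmul (ZMod m)]
  simp

instance (k : ℕ) : IsAddTorsionFree (homog ℤ α k) := .of_isTorsionFree ℤ _

theorem johnson_eq_iff [Finite α] {c : ℕ} (hc : 1 ≤ c) (φ ψ : andreadakis (FreeGroup α) c) :
    johnson α c hc φ = johnson α c hc ψ ↔
      φ.1⁻¹ * ψ.1 ∈ andreadakis (FreeGroup α) (c + 1) := by
  rw [← inv_mul_eq_one, ← map_inv, ← map_mul, johnson_eq_one_iff, Subgroup.mem_subgroupOf]
  rfl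

theorem lead_zmod_of_johnson_eq_pow {c m : ℕ} (hc : 1 ≤ c) {φ ψ : andreadakis (FreeGroup α) c}
    (h : johnson α c hc φ = johnson α c hc ψ ^ m) (i : α) :
    Lead (ZMod m) (c + 1) ((FreeGroup.of i)⁻¹ * φ.1 (FreeGroup.of i)) 0 := by
  let χ : FreeAlgebra ℤ α →ₐ[ℤ] FreeAlgebra (ZMod m) α :=
    FreeAlgebra.lift ℤ (FreeAlgebra.ι (ZMod m))
  have h1 := (johnson_apply hc φ i).map χ.toRingHom (fun i => by simp [χ])
  rw [h] at h1
  exact map_nsmul_homog_eq_zero χ.toRingHom (Multiplicative.toAdd (johnson α c hc ψ) i) ▸ h1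

/-- `G_c / ad(γ_c) G_{c+1}` is torsion-free. -/
theorem exists_conj_of_pow [Finite α] [Nontrivial α] {c m : ℕ} (hc : 1 ≤ c) (hm : m ≠ 0)
    {ψ : MulAut (FreeGroup α)} (hψ : ψ ∈ andreadakis (FreeGroup α) c) {y : FreeGroup α}
    (hy : y ∈ gamma (FreeGroup α) c)
    (h : (MulAut.conj y)⁻¹ * ψ ^ m ∈ andreadakis (FreeGroup α) (c + 1)) :
    ∃ u ∈ gamma (FreeGroup α) c,
      (MulAut.conj u)⁻¹ * ψ ∈ andreadakis (FreeGroup α) (c + 1) := by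
  have hJ : johnson α c hc ⟨_, conj_mem_andreadakis hy⟩ = johnson α c hc ⟨ψ, hψ⟩ ^ m := by
    rw [← map_pow]
    exact (johnson_eq_iff hc _ _).mpr h
  obtain ⟨u, hu, hw⟩ := exists_pow_of_commutator_lead m hc hy fun i => by
    rw [← inv_mul_conj_apply]
    exact lead_zmod_of_johnson_eq_pow hc hJ i
  refine ⟨u, hu, ?_⟩
  -- From `y ≡ u ^ m`, the Johnson images of `ad u` and `ψ` have equal `m`-th powers, hence agree in
  -- a torsion-free group.
  have h4 : johnson α c hc ⟨_, conj_mem_andreadakis hu⟩ ^ m =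
      johnson α c hc ⟨_, conj_mem_andreadakis hy⟩ := by
    rw [← map_pow]
    refine (johnson_eq_iff hc _ _).mpr ?_
    have h5 := conj_mem_andreadakis hw
    rw [map_mul, map_inv, map_pow] at h5
    exact h5
  exact (johnson_eq_iff hc ⟨_, conj_mem_andreadakis hu⟩ ⟨ψ, hψ⟩).mp
    (pow_left_injective hm (h4.trans hJ))

end Johnson

/-! ### The exact sequence. -/

section Exactness

variable {α : Type} [Finite α]

theorem isFreeAbelian_gammaQuot {c : ℕ} (hc : 1 ≤ c) :
    IsFreeAbelian (GammaQuot (FreeGroup α) c) := by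
  obtain ⟨h1, h2, h3⟩ := quotient_fg_torsionFree
    (N := (gamma (FreeGroup α) (c + 1)).subgroupOf (gamma (FreeGroup α) c))
    (leadHom α c hc) fun _ => leadHom_eq_one_iff hc
  exact isFreeAbelian_of_fg h1 h2 h3

theorem andreadakisQuot_fg_torsionFree {c : ℕ} (hc : 1 ≤ c) :
    (∀ a b : AndreadakisQuot (FreeGroup α) c, a * b = b * a) ∧
      Group.FG (AndreadakisQuot (FreeGroup α) c) ∧
      ∀ (a : AndreadakisQuot (FreeGroup α) c) (m : ℕ), m ≠ 0 → a ^ m = 1 → a = 1 :=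
  quotient_fg_torsionFree (johnson α c hc) (johnson_eq_one_iff hc)

theorem projQuot_surjective (F : Type*) [Group F] (c : ℕ) :
    Function.Surjective (projQuot F c) := by
  intro q
  induction q using QuotientGroup.induction_on with
  | H g =>
    obtain ⟨ψ, rfl⟩ := MonoidHom.subgroupMap_surjective (proj F) (andreadakis F c) g
    exact ⟨(ψ : AndreadakisQuot F c), rfl⟩

theorem projQuot_mk_eq_one_iff [Nontrivial α] {c : ℕ} (hc : 1 ≤ c)
    (ψ : andreadakis (FreeGroup α) c) :
    projQuot (FreeGroup α) c (ψ : AndreadakisQuot (FreeGroup α) c) = 1 ↔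
      ∃ y ∈ gamma (FreeGroup α) c,
        (MulAut.conj y)⁻¹ * ψ.1 ∈ andreadakis (FreeGroup α) (c + 1) := by
  rw [← proj_mem_outFiltration_iff hc ψ.2]
  exact QuotientGroup.eq_one_iff _

/-- Commutativity and finite generation descend along the surjection from `G_c / G_{c+1}`;
torsion-freeness does not, and comes from `exists_conj_of_pow`. -/
theorem isFreeAbelian_outQuot [Nontrivial α] {c : ℕ} (hc : 1 ≤ c) :
    IsFreeAbelian (OutQuot (FreeGroup α) c) := by
  obtain ⟨h1, h2, -⟩ := andreadakisQuot_fg_torsionFree (α := α) hc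
  have hs := projQuot_surjective (FreeGroup α) c
  refine isFreeAbelian_of_fg ?_ (Group.fg_of_surjective hs) ?_
  · intro a b
    obtain ⟨a, rfl⟩ := hs a
    obtain ⟨b, rfl⟩ := hs b
    rw [← map_mul, h1, map_mul]
  · intro a m hm ha
    obtain ⟨a, rfl⟩ := hs a
    induction a using QuotientGroup.induction_on with
    | H ψ =>
      rw [← map_pow] at ha
      obtain ⟨y, hy, h⟩ := (projQuot_mk_eq_one_iff hc (ψ ^ m)).mp ha
      exact (projQuot_mk_eq_one_iff hc ψ).mpr (exists_conj_of_pow hc hm ψ.2 hy h)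

theorem adQuot_injective [Nontrivial α] {c : ℕ} (hc : 1 ≤ c) :
    Function.Injective (adQuot (FreeGroup α) c) := by
  rw [injective_iff_map_eq_one]
  intro a ha
  induction a using QuotientGroup.induction_on with
  | H y =>
    have h : MulAut.conj y.1 ∈ andreadakis (FreeGroup α) (c + 1) :=
      (QuotientGroup.eq_one_iff (adRestrict (FreeGroup α) c y)).mp ha
    exact (QuotientGroup.eq_one_iff _).mpr (mem_gamma_of_conj_mem (by omega) h)

theorem adQuot_projQuot_exact [Nontrivial α] {c : ℕ} (hc : 1 ≤ c) :
    Function.MulExact (adQuot (FreeGroup α) c) (projQuot (FreeGroup α) c) := by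
  intro a
  induction a using QuotientGroup.induction_on with
  | H ψ =>
    rw [projQuot_mk_eq_one_iff hc]
    constructor
    · rintro ⟨y, hy, h⟩
      exact ⟨((⟨y, hy⟩ : gamma (FreeGroup α) c) : GammaQuot (FreeGroup α) c),
        (QuotientGroup.eq (a := adRestrict (FreeGroup α) c ⟨y, hy⟩)).mpr h⟩
    · rintro ⟨b, hb⟩
      induction b using QuotientGroup.induction_on with
      | H y => exact ⟨y, y.2, (QuotientGroup.eq (a := adRestrict (FreeGroup α) c y)).mp hb⟩

end Exactness

end AndreadakisOut

theorem mainTheorem6 (n c : ℕ) (hn : 2 ≤ n) (hc : 1 ≤ c) :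
    AndreadakisOut.IsFreeAbelian (AndreadakisOut.GammaQuot (FreeGroup (Fin n)) c) ∧
    AndreadakisOut.IsFreeAbelian (AndreadakisOut.AndreadakisQuot (FreeGroup (Fin n)) c) ∧
    AndreadakisOut.IsFreeAbelian (AndreadakisOut.OutQuot (FreeGroup (Fin n)) c) ∧
    Function.Injective (AndreadakisOut.adQuot (FreeGroup (Fin n)) c) ∧
    Function.MulExact (AndreadakisOut.adQuot (FreeGroup (Fin n)) c)
      (AndreadakisOut.projQuot (FreeGroup (Fin n)) c) ∧
    Function.Surjective (AndreadakisOut.projQuot (FreeGroup (Fin n)) c) := by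
  have : Nontrivial (Fin n) := Fin.nontrivial_iff_two_le.mpr hn
  obtain ⟨h1, h2, h3⟩ := AndreadakisOut.andreadakisQuot_fg_torsionFree (α := Fin n) hc
  exact ⟨AndreadakisOut.isFreeAbelian_gammaQuot hc, AndreadakisOut.isFreeAbelian_of_fg h1 h2 h3,
    AndreadakisOut.isFreeAbelian_outQuot hc, AndreadakisOut.adQuot_injective hc,
    AndreadakisOut.adQuot_projQuot_exact hc, AndreadakisOut.projQuot_surjective _ c⟩
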